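/- **Setting.** A source $S$ communicates with a destination $D$ through one of two decode-and-forward relays $R_1,R_2$ over the four free-space optical links $SR_i$, $R_iD$ ($i=1,2$). In time slot $j=0,1,2,\dots$ the instantaneous SNR of the link $AB$ is $$\gamma_{AB}^j=\frac{\eta^2\rho_{AB}^2T_b^2P_t^2\,(\bar h_{AB}\tilde h_{AB}^j)^2}{N_0},$$ where the responsivity $\eta$, slot duration $T_b$, total power $P_t$ and noise level $N_0$ are positive, $\rho_{AB}>0$ is the fixed share of the power given to the link (in the protocol $\rho_{SR_i}+\rho_{R_iD}=1$; only positivity is needed), $\bar h_{AB}>0$ is the path loss coefficient, and $\tilde h_{AB}^j$ has the Gamma-Gamma distribution with parameters $\alpha_{AB},\beta_{AB}>0$, whose density is $$f(x)=\frac{2(\alpha\beta)^{\frac{\alpha+\beta}2}}{\Gamma(\alpha)\Gamma(\beta)}\,x^{\frac{\alpha+\beta}2-1}K_{\alpha-\beta}\bigl(2\sqrt{\alpha\beta x}\bigr),\qquad x>0,$$ $K_\nu$ being the modified Bessel function of the second kind. In each slot the four fading coefficients are independent, and $\alpha_{AB}-\beta_{AB}\notin\mathbb Z$ for every link. Put $p_{AB}=\max(\alpha_{AB},\beta_{AB})$,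 $q_{AB}=\min(\alpha_{AB},\beta_{AB})$, and let $P_M=\eta T_bP_t/\sqrt{N_0\gamma_{th}}$ be the power margin, where $\gamma_{th}>0$ is the outage threshold SNR. **Protocol.** Let $\gamma_i^j=\min(\gamma_{SR_i}^j,\gamma_{R_iD}^j)$. In distributed switch and stay combining (DSSC) with switching threshold $T>0$, if the relay active in slot $j-1$ is $R_i$, then the relay active in slot $j\ge1$ is again $R_i$ when $\gamma_i^j\ge T$, and is the other relay when $\gamma_i^j<T$. The relay active in slot $0$ is arbitrary (possibly random, and possibly depending on $T$ and on the parameters of the system). The outage probability $P_{out}(T)$ in slot $j$ is the probability that the active relay $R_b^j$ of that slot has $\gamma_b^j<\gamma_{th}$. **Claim.** Fix a slot $j\ge1$. For all values of $\eta,T_b,P_t,N_0,\gamma_{th}$, $P_{out}(T)$ is minimized over $T>0$ by $T=\gamma_{th}$. The minimum outage probability $P_{out}(\gamma_{th})$ is asymptotically equivalent (the ratio tends to $1$), as $P_M\to\infty$ in any manner, to the select-max asymptotic expression with $N=2$ relays, $$\prod_{b=1}^{2}\left(\frac{\Gamma(p_{SR_b}-q_{SR_b})}{q_{SR_b}\Gamma(\alpha_{SR_b})\Gamma(\beta_{SR_b})}\left(\frac{\alpha_{SR_b}\beta_{SR_b}}{\bar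 h_{SR_b}\rho_{SR_b}P_M}\right)^{q_{SR_b}}+\frac{\Gamma(p_{R_bD}-q_{R_bD})}{q_{R_bD}\Gamma(\alpha_{R_bD})\Gamma(\beta_{R_bD})}\left(\frac{\alpha_{R_bD}\beta_{R_bD}}{\bar h_{R_bD}\rho_{R_bD}P_M}\right)^{q_{R_bD}}\right).$$ Its diversity gain $G_d=-\lim_{P_M\to\infty}\frac{\log P_{out}}{\log P_M}$ exists and equals $$G_d=\sum_{i=1}^{2}\min(q_{SR_i},q_{R_iD}),$$ and this is the largest diversity gain that DSSC can achieve, over all choices of the threshold $T>0$ as a function of the parameters $\eta,T_b,P_t,N_0,\gamma_{th}$ for which the limit exists. -/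

import Mathlib

open MeasureTheory ProbabilityTheory Filter Topology Asymptotics

noncomputable section

namespace FSO

/-! ### The Gamma-Gamma fading law -/

/-- The modified Bessel function of the second kind `K_ν(z)` for real order `ν` and `z > 0`,
through its integral representation `K_ν(z) = ∫₀^∞ exp(-z cosh t) cosh(ν t) dt`. -/
def besselK (ν z : ℝ) : ℝ :=
  ∫ t in Set.Ioi (0 : ℝ), Real.exp (-z * Real.cosh t) * Real.cosh (ν * t)

/-- The probability density function of the (unit mean) Gamma-Gamma distribution with
parameters `α, β`; it vanishes off the positive half-line. -/
def gammaGammaPDF (α β x : ℝ) : ℝ :=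
  if 0 < x then
    2 * (α * β) ^ ((α + β) / 2) / (Real.Gamma α * Real.Gamma β)
      * x ^ ((α + β) / 2 - 1) * besselK (α - β) (2 * Real.sqrt (α * β * x))
  else 0

/-- The Gamma-Gamma distribution. -/
def gammaGamma (α β : ℝ) : Measure ℝ :=
  volume.withDensity fun x => ENNReal.ofReal (gammaGammaPDF α β x)

/-! ### Links, operating points and signal-to-noise ratios -/

/-- The constant parameters of one optical link `A → B`. -/
structure Link where
  /-- first Gamma-Gamma parameter -/
  α : ℝ
  /-- second Gamma-Gamma parameter -/
  β : ℝ
  /-- path loss coefficient -/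
  hbar : ℝ
  /-- share of the total optical power that is allocated to this link -/
  ρ : ℝ
  α_pos : 0 < α
  β_pos : 0 < β
  hbar_pos : 0 < hbar
  ρ_pos : 0 < ρ

/-- `p = max(α, β)`. -/
def Link.p (L : Link) : ℝ := max L.α L.β

/-- `q = min(α, β)`. -/
def Link.q (L : Link) : ℝ := min L.α L.β

/-- The two hops of a relayed path: source to relay and relay to destination. -/
inductive Hop where
  | SR
  | RD

/-- The common physical parameters at which the system is operated. -/
structure OperatingPoint where
  /-- photodetector responsivity -/
  η : ℝ
  /-- slot duration -/
  Tb : ℝ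
  /-- total transmitted optical power -/
  Pt : ℝ
  /-- noise level -/
  N0 : ℝ
  /-- outage threshold SNR -/
  γth : ℝ
  η_pos : 0 < η
  Tb_pos : 0 < Tb
  Pt_pos : 0 < Pt
  N0_pos : 0 < N0
  γth_pos : 0 < γth

/-- The power margin `P_M = η T_b P_t / √(N₀ γ_th)`. -/
def OperatingPoint.powerMargin (s : OperatingPoint) : ℝ :=
  s.η * s.Tb * s.Pt / Real.sqrt (s.N0 * s.γth)

/-- The instantaneous SNR `η² ρ² T_b² P_t² h² / N₀` of a link whose channel gain is
`h = hbar * htilde`, with fading coefficient `htilde`. -/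
def snr (s : OperatingPoint) (L : Link) (htilde : ℝ) : ℝ :=
  s.η ^ 2 * L.ρ ^ 2 * s.Tb ^ 2 * s.Pt ^ 2 * (L.hbar * htilde) ^ 2 / s.N0

/-- The min equivalent SNR `γ_i = min(γ_{SR_i}, γ_{R_i D})` of the path through relay `i`,
given the fading coefficients `htilde` of all links. -/
def minSNR {N : ℕ} (s : OperatingPoint) (L : Fin N → Hop → Link)
    (htilde : Fin N × Hop → ℝ) (i : Fin N) : ℝ :=
  min (snr s (L i .SR) (htilde (i, .SR))) (snr s (L i .RD) (htilde (i, .RD)))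

/-! ### The distributed switch and stay protocol -/

/-- The active relay in slot `j`, for switching threshold `T`, path SNRs `γ j i` in slot `j`, and
active relay `r₀` in slot `0`. The active relay is kept when its current path SNR is at
least `T`; otherwise the other relay is used, whatever its SNR. (`Fin.rev` exchanges the two
elements of `Fin 2`.) -/
def activeRelay (T : ℝ) (γ : ℕ → Fin 2 → ℝ) (r₀ : Fin 2) : ℕ → Fin 2
  | 0 => r₀
  | j + 1 =>
    let r := activeRelay T γ r₀ j
    if T ≤ γ (j + 1) r then r else r.rev

/-- The outage probability of the protocol in slot `j` with switching threshold `T`: the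
probability that the path through the active relay has min equivalent SNR below the outage
threshold. Here `htilde j` holds the fading coefficients in slot `j`, and `r₀` is the relay that
is active in slot `0`. -/
def dsscOutage {Ω : Type*} [MeasurableSpace Ω] (P : Measure Ω) (s : OperatingPoint)
    (L : Fin 2 → Hop → Link) (htilde : ℕ → Fin 2 × Hop → Ω → ℝ) (r₀ : Ω → Fin 2)
    (T : ℝ) (j : ℕ) : ℝ :=
  P.real {ω |
    let γ : ℕ → Fin 2 → ℝ := fun k i => minSNR s L (fun e => htilde k e ω) i
    γ j (activeRelay T γ (r₀ ω) j) < s.γth}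

/-! ### The asymptotic expressions -/

/-- The leading term of the outage probability of a single link at power margin `PM`:
`Γ(p - q) / (Γ(α) Γ(β)) * (α β / (hbar ρ PM))^q / q`. -/
def Link.outageTerm (L : Link) (PM : ℝ) : ℝ :=
  Real.Gamma (L.p - L.q) / L.q / (Real.Gamma L.α * Real.Gamma L.β)
    * (L.α * L.β / L.hbar / (L.ρ * PM)) ^ L.q

/-- The asymptotic expression of the select-max protocol with `N` relays. -/
def selectMaxAsymptotic {N : ℕ} (L : Fin N → Hop → Link) (PM : ℝ) : ℝ :=
  ∏ b : Fin N, ((L b .SR).outageTerm PM + (L b .RD).outageTerm PM)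

/-- `G` is the diversity gain of an outage probability `Pout`, as the power margin grows
along `l`: `G = - lim log Pout / log P_M`. -/
def HasDiversityGain (l : Filter OperatingPoint) (Pout : OperatingPoint → ℝ) (G : ℝ) : Prop :=
  Tendsto (fun s => -(Real.log (Pout s) / Real.log s.powerMargin)) l (𝓝 G)

end FSO

end

namespace FSO

/-! When `T = γ_th`, staying means the kept path is not in outage, and switching means the abandoned
one is; so the active relay is in outage exactly when both paths are (`lt_activeRelay_self_iff`).
For any threshold and initial relay, both paths in outage forces an outage, so `γ_th` is optimal. By
independence the minimum is a product over relays of `F + G - F * G`, with `F`, `G` the outage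
probabilities of the two hops, i.e. Gamma-Gamma distribution functions at `1 / (hbar ρ P_M)`. The
behaviour of `K_ν` at `0` makes the density `∼ c x ^ (q - 1)`, hence `F ∼ (c / q) x ^ q`, while `F *
G` is negligible. Taking logarithms gives the diversity gain; a larger outage probability has a
smaller gain. -/

/-! ### The Gamma-Gamma density and distribution function near the origin. -/

lemma besselK_abs (ν z : ℝ) : besselK |ν| z = besselK ν z := by
  unfold besselK
  refine integral_congr_ae (ae_of_all _ fun t => ?_)
  rcases abs_choice ν with h | h <;> simp [h]

/-- The substitution `v = w * exp t` in the integral representation of `K_ν(2 w)`. -/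
lemma rpow_mul_besselK (ν : ℝ) {w : ℝ} (hw : 0 < w) :
    w ^ ν * besselK ν (2 * w) = ∫ v in Set.Ioi (0 : ℝ), (Set.Ioi w).indicator (fun v =>
      v⁻¹ * Real.exp (-v - w ^ 2 / v) * ((v ^ ν + w ^ (2 * ν) * v ^ (-ν)) / 2)) v := by
  -- For `u = exp t`, `2 * cosh t = u + u⁻¹`; the factor `u⁻¹` cancels the Jacobian.
  let g : ℝ → ℝ := fun u => u⁻¹ * Real.exp (-w * (u + u⁻¹)) * ((u ^ ν + u ^ (-ν)) / 2)
  have h1 : besselK ν (2 * w) = ∫ u in Set.Ioi (1 : ℝ), g u := by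
    have := integral_comp_exp_Ioi g 0
    rw [Real.exp_zero] at this
    rw [← this, besselK]
    refine integral_congr_ae (ae_of_all _ fun t => ?_)
    simp only [g, smul_eq_mul, Real.cosh_eq, ← Real.exp_mul, ← Real.exp_neg]
    rw [← mul_assoc, ← mul_assoc, ← Real.exp_add, add_neg_cancel, Real.exp_zero, one_mul]
    ring_nf
  have h2 := integral_comp_mul_left_Ioi g w (inv_pos.2 hw)
  rw [inv_mul_cancel₀ hw.ne', inv_inv, smul_eq_mul] at h2
  have h3 : (∫ u in Set.Ioi (1 : ℝ), g u) = w⁻¹ * ∫ v in Set.Ioi w, g (w⁻¹ * v) := by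
    rw [h2, inv_mul_cancel_left₀ hw.ne']
  rw [setIntegral_indicator measurableSet_Ioi, Set.Ioi_inter_Ioi, sup_eq_right.2 hw.le, h1, h3,
    ← mul_assoc, ← integral_const_mul]
  refine setIntegral_congr_fun measurableSet_Ioi fun v hv => ?_
  have hv0 : 0 < v := hw.trans hv
  have e1 : (w⁻¹ * v) ^ ν = (w ^ ν)⁻¹ * v ^ ν := by
    rw [Real.mul_rpow (by positivity) hv0.le, Real.inv_rpow hw.le]
  have e2 : (w⁻¹ * v) ^ (-ν) = w ^ ν * v ^ (-ν) := by
    rw [Real.mul_rpow (by positivity) hv0.le, Real.inv_rpow hw.le, Real.rpow_neg hw.le, inv_inv]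
  have e3 : w ^ (2 * ν) = w ^ ν * w ^ ν := by rw [two_mul, Real.rpow_add hw]
  have e4 : -w * (w⁻¹ * v + (w⁻¹ * v)⁻¹) = -v - w ^ 2 / v := by field_simp; ring
  simp only [g, e1, e2, e3, e4]
  have : 0 < w ^ ν := Real.rpow_pos_of_pos hw _
  field_simp

/-- The behaviour of `K_ν` at the origin: `K_ν(z) ∼ Γ(ν) / 2 * (2 / z) ^ ν`. -/
lemma tendsto_rpow_mul_besselK {ν : ℝ} (hν : 0 < ν) :
    Tendsto (fun w => w ^ ν * besselK ν (2 * w)) (𝓝[>] 0) (𝓝 (Real.Gamma ν / 2)) := by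
  have hev : ∀ᶠ w : ℝ in 𝓝[>] 0, 0 < w := self_mem_nhdsWithin
  have hΓ : Real.Gamma ν / 2 =
      ∫ v in Set.Ioi (0 : ℝ), Real.exp (-v) * v ^ (ν - 1) / 2 := by
    rw [Real.Gamma_eq_integral hν, integral_div]
  rw [hΓ]
  refine Tendsto.congr' (hev.mono fun w hw => (rpow_mul_besselK ν hw).symm) ?_
  -- The indicator keeps the domain fixed. On `v > w`, `w ^ (2ν) * v ^ (-ν) ≤ v ^ ν`, so the Gamma
  -- integrand dominates.
  refine tendsto_integral_filter_of_dominated_convergence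
    (fun v => Real.exp (-v) * v ^ (ν - 1)) ?_ ?_ (Real.GammaIntegral_convergent hν) ?_
  · refine Eventually.of_forall fun w => Measurable.aestronglyMeasurable ?_
    exact Measurable.indicator (by fun_prop) measurableSet_Ioi
  · filter_upwards [hev] with w hw
    refine (ae_restrict_mem measurableSet_Ioi).mono fun v hv => ?_
    have hv0 : 0 < v := hv
    by_cases hwv : v ∈ Set.Ioi w
    · rw [Set.indicator_of_mem hwv, Real.norm_of_nonneg (by positivity)]
      have h1 : w ^ (2 * ν) * v ^ (-ν) ≤ v ^ ν := by
        have : w ^ (2 * ν) ≤ v ^ (2 * ν) :=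
          Real.rpow_le_rpow hw.le (le_of_lt hwv) (by positivity)
        calc w ^ (2 * ν) * v ^ (-ν) ≤ v ^ (2 * ν) * v ^ (-ν) := by gcongr
          _ = v ^ ν := by rw [← Real.rpow_add hv0]; ring_nf
      have h2 : Real.exp (-v - w ^ 2 / v) ≤ Real.exp (-v) := by
        gcongr; have : 0 ≤ w ^ 2 / v := by positivity
        linarith
      calc _ ≤ v⁻¹ * Real.exp (-v) * ((v ^ ν + v ^ ν) / 2) := by gcongr
        _ = Real.exp (-v) * v ^ (ν - 1) := by
          rw [Real.rpow_sub_one hv0.ne']; field_simp; ring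
    · rw [Set.indicator_of_notMem hwv, norm_zero]; positivity
  · refine (ae_restrict_mem measurableSet_Ioi).mono fun v hv => ?_
    have hv0 : 0 < v := hv
    have hlt : ∀ᶠ w : ℝ in 𝓝[>] 0, w < v := nhdsWithin_le_nhds (gt_mem_nhds hv0)
    refine Tendsto.congr' (hlt.mono fun w hw => (Set.indicator_of_mem (s := Set.Ioi w) hw _).symm) ?_
    have hc : ContinuousAt (fun w : ℝ => v⁻¹ * Real.exp (-v - w ^ 2 / v)
        * ((v ^ ν + w ^ (2 * ν) * v ^ (-ν)) / 2)) 0 := by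
      have : ContinuousAt (fun w : ℝ => w ^ (2 * ν)) 0 :=
        Real.continuousAt_rpow_const _ _ (Or.inr (by positivity))
      fun_prop
    have := hc.tendsto.mono_left (nhdsWithin_le_nhds (s := Set.Ioi 0))
    convert this using 2
    rw [Real.zero_rpow (by positivity), Real.rpow_sub_one hv0.ne']
    simp; ring

/-- Since `(α + β) / 2 = min α β + |α - β| / 2`, the surplus powers combine into the factor that
gives `K` a finite limit at `0`. -/
lemma gammaGammaPDF_eq {α β x : ℝ} (hα : 0 < α) (hβ : 0 < β) (hx : 0 < x) :
    gammaGammaPDF α β x = 2 * (α * β) ^ min α β / (Real.Gamma α * Real.Gamma β)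
      * (Real.sqrt (α * β * x) ^ |α - β| * besselK |α - β| (2 * Real.sqrt (α * β * x)))
      * x ^ (min α β - 1) := by
  have hab : 0 < α * β := mul_pos hα hβ
  have hm : (α + β) / 2 = min α β + |α - β| / 2 := by
    rcases le_total α β with h | h
    · rw [min_eq_left h, abs_of_nonpos (sub_nonpos.2 h)]; ring
    · rw [min_eq_right h, abs_of_nonneg (sub_nonneg.2 h)]; ring
  rw [gammaGammaPDF, if_pos hx, besselK_abs]
  generalize besselK (α - β) (2 * Real.sqrt (α * β * x)) = K
  rw [hm, add_sub_right_comm, Real.rpow_add hab,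
    Real.rpow_add hx, Real.sqrt_eq_rpow, ← Real.rpow_mul (by positivity),
    Real.mul_rpow hab.le hx.le]
  ring_nf

lemma tendsto_gammaGammaPDF_div {α β : ℝ} (hα : 0 < α) (hβ : 0 < β) (h : α ≠ β) :
    Tendsto (fun x => gammaGammaPDF α β x / x ^ (min α β - 1)) (𝓝[>] 0)
      (𝓝 (Real.Gamma |α - β| / (Real.Gamma α * Real.Gamma β) * (α * β) ^ min α β)) := by
  have hab : 0 < α * β := mul_pos hα hβ
  have hs : Tendsto (fun x => Real.sqrt (α * β * x)) (𝓝[>] 0) (𝓝[>] 0) := by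
    refine tendsto_nhdsWithin_iff.2 ⟨?_, ?_⟩
    · have : ContinuousAt (fun x => Real.sqrt (α * β * x)) 0 := by fun_prop
      simpa using this.tendsto.mono_left (nhdsWithin_le_nhds (s := Set.Ioi 0))
    · filter_upwards [self_mem_nhdsWithin] with x hx
      exact Real.sqrt_pos.2 (mul_pos hab hx)
  have h1 := ((tendsto_rpow_mul_besselK (abs_pos.2 (sub_ne_zero.2 h))).comp hs).const_mul
    (2 * (α * β) ^ min α β / (Real.Gamma α * Real.Gamma β))
  convert h1.congr' ?_ using 2
  · ring
  · filter_upwards [self_mem_nhdsWithin] with x hx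
    rw [gammaGammaPDF_eq hα hβ hx, mul_div_cancel_right₀ _ (Real.rpow_pos_of_pos hx _).ne']
    rfl

lemma lintegral_Ioo_rpow {q c x : ℝ} (hq : 0 < q) (hc : 0 ≤ c) (hx : 0 < x) :
    ∫⁻ t in Set.Ioo 0 x, ENNReal.ofReal (c * t ^ (q - 1)) = ENNReal.ofReal (c / q * x ^ q) := by
  have hint : IntervalIntegrable (fun t : ℝ => c * t ^ (q - 1)) volume 0 x :=
    (intervalIntegral.intervalIntegrable_rpow' (by linarith)).const_mul c
  rw [intervalIntegrable_iff_integrableOn_Ioo_of_le hx.le] at hint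
  rw [← ofReal_integral_eq_lintegral_ofReal hint, ← integral_Ioc_eq_integral_Ioo,
    ← intervalIntegral.integral_of_le hx.le, intervalIntegral.integral_const_mul,
    integral_rpow (Or.inl (by linarith))]
  · rw [sub_add_cancel, Real.zero_rpow hq.ne']; congr 1; ring
  · refine (ae_restrict_mem measurableSet_Ioo).mono fun t ht => ?_
    exact mul_nonneg hc (Real.rpow_nonneg ht.1.le _)

/-- A density asymptotic to `c * x ^ (q - 1)` at the origin, and zero on the negative half-line,
has distribution function asymptotic to `c / q * x ^ q`. -/
lemma tendsto_withDensity_Iio_div {f : ℝ → ℝ} (hf : ∀ x ≤ 0, f x = 0) {q c : ℝ} (hq : 0 < q)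
    (hc : 0 < c) (h : Tendsto (fun x => f x / x ^ (q - 1)) (𝓝[>] 0) (𝓝 c)) :
    Tendsto (fun x => (volume.withDensity fun t => ENNReal.ofReal (f t)).real (Set.Iio x) / x ^ q)
      (𝓝[>] 0) (𝓝 (c / q)) := by
  have hF (x : ℝ) : (volume.withDensity fun t => ENNReal.ofReal (f t)) (Set.Iio x)
      = ∫⁻ t in Set.Ioo 0 x, ENNReal.ofReal (f t) := by
    rw [withDensity_apply _ measurableSet_Iio, ← lintegral_indicator measurableSet_Iio,
      ← lintegral_indicator measurableSet_Ioo]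
    congr 1; ext t
    by_cases ht : 0 < t
    · simp [Set.indicator, ht]
    · simp [Set.indicator, ht, hf t (not_lt.1 ht)]
  -- Near `0` the density lies between `a * t ^ (q - 1)` and `b * t ^ (q - 1)`; integrate both
  -- bounds.
  have key (a b : ℝ) (ha : 0 ≤ a) (hac : a < c) (hcb : c < b) : ∀ᶠ x : ℝ in 𝓝[>] 0,
      a / q ≤ (volume.withDensity fun t => ENNReal.ofReal (f t)).real (Set.Iio x) / x ^ q ∧
      (volume.withDensity fun t => ENNReal.ofReal (f t)).real (Set.Iio x) / x ^ q ≤ b / q := by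
    have hev := h.eventually (Ioo_mem_nhds hac hcb)
    obtain ⟨δ, hδ, hδ'⟩ := mem_nhdsGT_iff_exists_Ioo_subset.1 hev
    filter_upwards [Ioo_mem_nhdsGT hδ] with x hx
    have hb : 0 ≤ b := by linarith
    have hbd (t : ℝ) (ht : t ∈ Set.Ioo 0 x) :
        a * t ^ (q - 1) ≤ f t ∧ f t ≤ b * t ^ (q - 1) := by
      have h2 := hδ' ⟨ht.1, ht.2.trans hx.2⟩
      have hp : 0 < t ^ (q - 1) := Real.rpow_pos_of_pos ht.1 _
      exact ⟨((lt_div_iff₀ hp).1 h2.1).le, ((div_lt_iff₀ hp).1 h2.2).le⟩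
    have hxq : 0 < x ^ q := Real.rpow_pos_of_pos hx.1 _
    have hle : ENNReal.ofReal (a / q * x ^ q) ≤
        (volume.withDensity fun t => ENNReal.ofReal (f t)) (Set.Iio x) := by
      rw [hF, ← lintegral_Ioo_rpow hq ha hx.1]
      exact setLIntegral_mono' measurableSet_Ioo fun t ht => ENNReal.ofReal_le_ofReal (hbd t ht).1
    have hge : (volume.withDensity fun t => ENNReal.ofReal (f t)) (Set.Iio x) ≤
        ENNReal.ofReal (b / q * x ^ q) := by
      rw [hF, ← lintegral_Ioo_rpow hq hb hx.1]
      exact setLIntegral_mono' measurableSet_Ioo fun t ht => ENNReal.ofReal_le_ofReal (hbd t ht).2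
    have hfin := hge.trans_lt ENNReal.ofReal_lt_top
    rw [le_div_iff₀ hxq, div_le_iff₀ hxq]
    exact ⟨(ENNReal.ofReal_le_iff_le_toReal hfin.ne).1 hle,
      ENNReal.toReal_le_of_le_ofReal (by positivity) hge⟩
  refine tendsto_order.2 ⟨fun u hu => ?_, fun u hu => ?_⟩
  -- The maximum with `0` keeps `a` nonnegative even if `u` is negative.
  · obtain ⟨a, ha1, ha2⟩ := exists_between (max_lt hc ((lt_div_iff₀ hq).1 hu))
    filter_upwards [key a (c + 1) ((le_max_left _ _).trans ha1.le) ha2 (by linarith)] with x hx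
    exact ((lt_div_iff₀ hq).2 ((le_max_right _ _).trans_lt ha1)).trans_le hx.1
  · obtain ⟨b, hb1, hb2⟩ := exists_between ((div_lt_iff₀ hq).1 hu)
    filter_upwards [key 0 b le_rfl hc hb1] with x hx
    exact hx.2.trans_lt ((div_lt_iff₀ hq).2 hb2)

/-! ### Asymptotics of link and path outage; diversity gain. -/

/-- The outage probability of a single link at power margin `PM`. -/
noncomputable def Link.outage (L : Link) (PM : ℝ) : ℝ :=
  (gammaGamma L.α L.β).real (Set.Iio (L.hbar * (L.ρ * PM))⁻¹)

lemma Link.q_pos (L : Link) : 0 < L.q := lt_min L.α_pos L.β_pos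

lemma Link.p_sub_q (L : Link) : L.p - L.q = |L.α - L.β| := by
  rw [Link.p, Link.q, max_sub_min_eq_abs, abs_sub_comm]

/-- The coefficient of `PM ^ (-q)` in `outageTerm`. -/
lemma Link.exists_outageTerm_eq (L : Link) (h : L.α ≠ L.β) :
    ∃ C : ℝ, 0 < C ∧ ∀ PM, 0 < PM → L.outageTerm PM = C * PM ^ (-L.q) := by
  have hα := L.α_pos
  have hβ := L.β_pos
  have hh := L.hbar_pos
  have hρ := L.ρ_pos
  have hq := L.q_pos
  have h1 : 0 < Real.Gamma (L.p - L.q) :=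
    Real.Gamma_pos_of_pos (by rw [L.p_sub_q]; exact abs_pos.2 (sub_ne_zero.2 h))
  have h2 := Real.Gamma_pos_of_pos hα
  have h3 := Real.Gamma_pos_of_pos hβ
  refine ⟨Real.Gamma (L.p - L.q) / L.q / (Real.Gamma L.α * Real.Gamma L.β)
    * (L.α * L.β / L.hbar / L.ρ) ^ L.q, by positivity, fun PM hPM => ?_⟩
  rw [Link.outageTerm, ← div_div _ L.ρ, Real.div_rpow (by positivity) hPM.le,
    Real.rpow_neg hPM.le]
  ring

lemma Link.outage_isEquivalent (L : Link) (h : L.α ≠ L.β) :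
    L.outage ~[atTop] L.outageTerm := by
  have hα := L.α_pos
  have hβ := L.β_pos
  have hh := L.hbar_pos
  have hρ := L.ρ_pos
  have hq := L.q_pos
  have h1 : 0 < Real.Gamma |L.α - L.β| :=
    Real.Gamma_pos_of_pos (abs_pos.2 (sub_ne_zero.2 h))
  have h2 := Real.Gamma_pos_of_pos hα
  have h3 := Real.Gamma_pos_of_pos hβ
  have hx : Tendsto (fun PM => (L.hbar * (L.ρ * PM))⁻¹) atTop (𝓝[>] 0) :=
    tendsto_inv_atTop_nhdsGT_zero.comp
      ((tendsto_id.const_mul_atTop hρ).const_mul_atTop hh)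
  have hc : 0 < Real.Gamma |L.α - L.β| / (Real.Gamma L.α * Real.Gamma L.β)
      * (L.α * L.β) ^ min L.α L.β := by positivity
  have hlim := (tendsto_withDensity_Iio_div (f := gammaGammaPDF L.α L.β)
    (fun x hx => if_neg hx.not_gt) hq hc
    (tendsto_gammaGammaPDF_div hα hβ h)).comp hx
  obtain ⟨C, hC, hCeq⟩ := L.exists_outageTerm_eq h
  refine isEquivalent_of_tendsto_one ?_
  have hlim' := hlim.div_const (Real.Gamma |L.α - L.β| / (Real.Gamma L.α * Real.Gamma L.β)
      * (L.α * L.β) ^ min L.α L.β / L.q)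
  rw [div_self (by positivity)] at hlim'
  refine hlim'.congr' ?_
  filter_upwards [eventually_gt_atTop 0] with PM hPM
  have e : L.α * L.β / L.hbar / (L.ρ * PM) = L.α * L.β * (L.hbar * (L.ρ * PM))⁻¹ := by
    field_simp
  simp only [Pi.div_apply, Function.comp, Link.outageTerm, Link.outage, gammaGamma, L.p_sub_q, e]
  rw [Real.mul_rpow (mul_pos hα hβ).le (y := (L.hbar * (L.ρ * PM))⁻¹) (by positivity), ← Link.q,
    div_div]
  congr 1
  ring

lemma Link.outageTerm_pos (L : Link) (h : L.α ≠ L.β) {PM : ℝ} (hPM : 0 < PM) :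
    0 < L.outageTerm PM := by
  obtain ⟨C, hC, hCeq⟩ := L.exists_outageTerm_eq h
  rw [hCeq PM hPM]; positivity

lemma Link.tendsto_outageTerm (L : Link) (h : L.α ≠ L.β) :
    Tendsto L.outageTerm atTop (𝓝 0) := by
  obtain ⟨C, hC, hCeq⟩ := L.exists_outageTerm_eq h
  have := (tendsto_rpow_neg_atTop L.q_pos).const_mul C
  rw [mul_zero] at this
  refine this.congr' ?_
  filter_upwards [eventually_gt_atTop 0] with PM hPM using (hCeq PM hPM).symm


/-- Positivity excludes cancellation: `u` and `v` are both `O(u + v)`. -/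
lemma isEquivalent_add_of_pos {ι : Type*} {l : Filter ι} {f g u v : ι → ℝ} (hf : f ~[l] u)
    (hg : g ~[l] v) (hu : ∀ᶠ x in l, 0 < u x) (hv : ∀ᶠ x in l, 0 < v x) :
    (f + g) ~[l] (u + v) := by
  have h1 : u =O[l] (u + v) := IsBigO.of_bound 1 (by
    filter_upwards [hu, hv] with x h1 h2
    rw [one_mul, Pi.add_apply, Real.norm_of_nonneg h1.le, Real.norm_of_nonneg (by positivity)]
    linarith)
  have h2 : v =O[l] (u + v) := IsBigO.of_bound 1 (by
    filter_upwards [hu, hv] with x h1 h2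
    rw [one_mul, Pi.add_apply, Real.norm_of_nonneg h2.le, Real.norm_of_nonneg (by positivity)]
    linarith)
  have h3 := (hf.isLittleO.trans_isBigO h1).add (hg.isLittleO.trans_isBigO h2)
  refine h3.congr_left fun x => ?_
  simp only [Pi.sub_apply, Pi.add_apply]; ring

/-- The outage probability of a path of two independent links. -/
noncomputable def pathOutage (L : Hop → Link) (PM : ℝ) : ℝ :=
  (L .SR).outage PM + (L .RD).outage PM - (L .SR).outage PM * (L .RD).outage PM

/-- The product of the hop outages is `o` of their sum, as one factor tends to `0`. -/
lemma pathOutage_isEquivalent (L : Hop → Link) (h : ∀ k, (L k).α ≠ (L k).β) :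
    pathOutage L ~[atTop] fun PM => (L .SR).outageTerm PM + (L .RD).outageTerm PM := by
  have hpos (k : Hop) : ∀ᶠ PM in atTop, 0 < (L k).outageTerm PM := by
    filter_upwards [eventually_gt_atTop 0] with PM hPM using (L k).outageTerm_pos (h k) hPM
  have hadd := isEquivalent_add_of_pos ((L .SR).outage_isEquivalent (h _))
    ((L .RD).outage_isEquivalent (h _)) (hpos _) (hpos _)
  have hbig : (L .SR).outageTerm =O[atTop]
      fun PM => (L .SR).outageTerm PM + (L .RD).outageTerm PM := IsBigO.of_bound 1 (by
    filter_upwards [hpos .SR, hpos .RD] with x h1 h2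
    rw [one_mul, Real.norm_of_nonneg h1.le, Real.norm_of_nonneg (by positivity)]
    linarith)
  have hsmall : (L .RD).outage =o[atTop] (fun _ => (1 : ℝ)) := by
    rw [isLittleO_one_iff]
    exact ((L .RD).outage_isEquivalent (h _)).symm.tendsto_nhds ((L .RD).tendsto_outageTerm (h _))
  have hprod : (fun PM => (L .SR).outage PM * (L .RD).outage PM) =o[atTop]
      fun PM => (L .SR).outageTerm PM + (L .RD).outageTerm PM := by
    simpa using
      (((L .SR).outage_isEquivalent (h _)).isBigO.trans hbig).mul_isLittleO hsmall
  exact hadd.sub_isLittleO hprod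

/-- Factoring out the power with the smaller exponent leaves a cofactor between `A` and `A + B`,
whose logarithm is bounded. -/
lemma log_add_rpow_div_log {a b A B : ℝ} (hA : 0 < A) (hB : 0 < B) :
    Tendsto (fun x : ℝ => Real.log (A * x ^ (-a) + B * x ^ (-b)) / Real.log x) atTop
      (𝓝 (-min a b)) := by
  wlog hab : a ≤ b generalizing a b A B
  · rw [min_comm]
    refine (this hB hA (le_of_not_ge hab)).congr fun x => ?_
    rw [add_comm]
  rw [min_eq_left hab]
  have hbound : Tendsto (fun x : ℝ => Real.log (A + B * x ^ (a - b)) / Real.log x)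
      atTop (𝓝 0) := by
    have hlo := (tendsto_const_nhds (x := Real.log A)).div_atTop Real.tendsto_log_atTop
    have hhi := (tendsto_const_nhds (x := Real.log (A + B))).div_atTop Real.tendsto_log_atTop
    refine tendsto_of_tendsto_of_tendsto_of_le_of_le' hlo hhi ?_ ?_
    · filter_upwards [eventually_gt_atTop 1] with x hx
      have := Real.log_pos hx
      have h0 : 0 < x ^ (a - b) := by positivity
      gcongr
      have : 0 < B * x ^ (a - b) := by positivity
      linarith
    · filter_upwards [eventually_gt_atTop 1] with x hx
      have := Real.log_pos hx
      have h0 : 0 < x ^ (a - b) := by positivity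
      have h1 : x ^ (a - b) ≤ 1 := Real.rpow_le_one_of_one_le_of_nonpos hx.le (by linarith)
      gcongr
      nlinarith
  have := hbound.const_add (-a)
  rw [add_zero] at this
  refine this.congr' ?_
  filter_upwards [eventually_gt_atTop 1] with x hx
  have hx0 : 0 < x := by linarith
  have hlog := Real.log_pos hx
  have e : A * x ^ (-a) + B * x ^ (-b) = x ^ (-a) * (A + B * x ^ (a - b)) := by
    rw [show -b = -a + (a - b) by ring, Real.rpow_add hx0]; ring
  rw [e, Real.log_mul (by positivity) (by positivity), Real.log_rpow hx0]
  field_simp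

lemma selectMaxAsymptotic_pos {N : ℕ} (L : Fin N → Hop → Link) (h : ∀ i k, (L i k).α ≠ (L i k).β)
    {PM : ℝ} (hPM : 0 < PM) : 0 < selectMaxAsymptotic L PM :=
  Finset.prod_pos fun i _ =>
    add_pos ((L i .SR).outageTerm_pos (h _ _) hPM) ((L i .RD).outageTerm_pos (h _ _) hPM)

lemma log_selectMaxAsymptotic_div_log {N : ℕ} (L : Fin N → Hop → Link)
    (h : ∀ i k, (L i k).α ≠ (L i k).β) :
    Tendsto (fun PM => Real.log (selectMaxAsymptotic L PM) / Real.log PM) atTop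
      (𝓝 (-∑ i, min (L i .SR).q (L i .RD).q)) := by
  rw [← Finset.sum_neg_distrib]
  have hi (i : Fin N) : Tendsto
      (fun PM => Real.log ((L i .SR).outageTerm PM + (L i .RD).outageTerm PM) / Real.log PM)
      atTop (𝓝 (-min (L i .SR).q (L i .RD).q)) := by
    obtain ⟨A, hA, hAeq⟩ := (L i .SR).exists_outageTerm_eq (h _ _)
    obtain ⟨B, hB, hBeq⟩ := (L i .RD).exists_outageTerm_eq (h _ _)
    refine (log_add_rpow_div_log hA hB).congr' ?_
    filter_upwards [eventually_gt_atTop 0] with PM hPM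
    rw [hAeq PM hPM, hBeq PM hPM]
  refine (tendsto_finsetSum _ fun i _ => hi i).congr' ?_
  filter_upwards [eventually_gt_atTop 0] with PM hPM
  rw [selectMaxAsymptotic, Real.log_prod, Finset.sum_div]
  exact fun i _ => (add_pos ((L i .SR).outageTerm_pos (h _ _) hPM)
    ((L i .RD).outageTerm_pos (h _ _) hPM)).ne'

lemma OperatingPoint.powerMargin_pos (s : OperatingPoint) : 0 < s.powerMargin :=
  div_pos (mul_pos (mul_pos s.η_pos s.Tb_pos) s.Pt_pos)
    (Real.sqrt_pos.2 (mul_pos s.N0_pos s.γth_pos))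

lemma hasDiversityGain_of_isEquivalent {N : ℕ} {L : Fin N → Hop → Link}
    (h : ∀ i k, (L i k).α ≠ (L i k).β) {l : Filter OperatingPoint}
    (hl : Tendsto OperatingPoint.powerMargin l atTop) {Pout : OperatingPoint → ℝ}
    (hP : Pout ~[l] fun s => selectMaxAsymptotic L s.powerMargin) :
    HasDiversityGain l Pout (∑ i, min (L i .SR).q (L i .RD).q) := by
  have hpos (s : OperatingPoint) : 0 < selectMaxAsymptotic L s.powerMargin :=
    selectMaxAsymptotic_pos L h s.powerMargin_pos
  have h1 := (isEquivalent_iff_tendsto_one (Eventually.of_forall fun s => (hpos s).ne')).1 hP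
  have h2 := (h1.log one_ne_zero).div_atTop (Real.tendsto_log_atTop.comp hl)
  have h3 := (((log_selectMaxAsymptotic_div_log L h).comp hl).add h2).neg
  rw [add_zero, neg_neg] at h3
  refine h3.congr' ?_
  filter_upwards [h1.eventually (lt_mem_nhds one_pos)] with s hs
  -- A ratio near `1` excludes `Pout s = 0`, where the logarithm would not split.
  have hne : Pout s ≠ 0 := by
    rintro h0
    simp [h0] at hs
  simp only [Function.comp, Pi.div_apply]
  rw [Real.log_div hne (hpos s).ne', ← add_div, add_sub_cancel]

/-! ### From SNR events to outage probabilities. -/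

/-- The quotient `snr / γ_th` is `(hbar ρ P_M x) ^ 2`, so the operating point enters only through
the power margin. -/
lemma snr_lt_iff (s : OperatingPoint) (L : Link) {x : ℝ} (hx : 0 < x) :
    snr s L x < s.γth ↔ x < (L.hbar * (L.ρ * s.powerMargin))⁻¹ := by
  have h1 := L.hbar_pos
  have h2 := L.ρ_pos
  have h3 := s.powerMargin_pos
  have h4 := s.γth_pos
  have h5 := s.N0_pos
  have e : snr s L x = (L.hbar * (L.ρ * s.powerMargin) * x) ^ 2 * s.γth := by
    rw [snr, OperatingPoint.powerMargin]
    have h6 : Real.sqrt (s.N0 * s.γth) ^ 2 = s.N0 * s.γth := Real.sq_sqrt (by positivity)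
    simp only [mul_pow, div_pow, h6]
    field_simp
  rw [e, mul_lt_iff_lt_one_left h4, sq_lt_one_iff₀ (by positivity), inv_eq_one_div,
    lt_div_iff₀' (by positivity)]

lemma measurable_snr (s : OperatingPoint) (L : Link) : Measurable (snr s L) := by
  unfold snr; fun_prop

lemma gammaGamma_Iic (α β : ℝ) : gammaGamma α β (Set.Iic 0) = 0 := by
  rw [gammaGamma, withDensity_apply _ measurableSet_Iic]
  refine (setLIntegral_congr_fun measurableSet_Iic fun x hx => ?_).trans lintegral_zero
  simp [gammaGammaPDF, not_lt.2 (Set.mem_Iic.1 hx)]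

/-- The SNR is even in the fading, so the two events agree only almost everywhere, off the null set
`x ≤ 0`. -/
lemma gammaGamma_snr_lt (s : OperatingPoint) (L : Link) :
    (gammaGamma L.α L.β).real {x | snr s L x < s.γth} = L.outage s.powerMargin := by
  refine measureReal_congr ?_
  have hae : ∀ᵐ x ∂(gammaGamma L.α L.β), 0 < x := by
    rw [ae_iff]
    simpa [Set.Iic] using gammaGamma_Iic L.α L.β
  filter_upwards [hae] with x hx
  exact propext (snr_lt_iff s L hx)

section Probability

variable {Ω : Type*} [MeasurableSpace Ω] {P : Measure Ω} {N : ℕ} {L : Fin N → Hop → Link}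
  {X : Fin N × Hop → Ω → ℝ}

lemma minSNR_lt_iff (s : OperatingPoint) (L : Fin N → Hop → Link) (x : Fin N × Hop → ℝ)
    (i : Fin N) : minSNR s L x i < s.γth ↔
      snr s (L i .SR) (x (i, .SR)) < s.γth ∨ snr s (L i .RD) (x (i, .RD)) < s.γth :=
  min_lt_iff

lemma measureReal_minSNR_lt [IsProbabilityMeasure P]
    (hlaw : ∀ e, HasLaw (X e) (gammaGamma (L e.1 e.2).α (L e.1 e.2).β) P)
    (hindep : iIndepFun X P) (s : OperatingPoint) (i : Fin N) :
    P.real {ω | minSNR s L (fun e => X e ω) i < s.γth} = pathOutage (L i) s.powerMargin := by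
  have hS (k : Hop) : MeasurableSet {x | snr s (L i k) x < s.γth} :=
    measurableSet_lt (measurable_snr s _) measurable_const
  have hk (k : Hop) : P.real (X (i, k) ⁻¹' {x | snr s (L i k) x < s.γth})
      = (L i k).outage s.powerMargin := by
    rw [← gammaGamma_snr_lt s (L i k)]
    exact (hlaw (i, k)).measureReal_eq (hS k)
  have hinter : P.real (X (i, .SR) ⁻¹' {x | snr s (L i .SR) x < s.γth} ∩
      X (i, .RD) ⁻¹' {x | snr s (L i .RD) x < s.γth})
      = (L i .SR).outage s.powerMargin * (L i .RD).outage s.powerMargin := by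
    rw [← hk, ← hk, measureReal_def, (hindep.indepFun (i := (i, Hop.SR)) (j := (i, Hop.RD))
      (by simp)).measure_inter_preimage_eq_mul _ _ (hS _) (hS _), ENNReal.toReal_mul]
    rfl
  have hunion := measureReal_union_add_inter₀ (μ := P)
    (s := X (i, .SR) ⁻¹' {x | snr s (L i .SR) x < s.γth})
    (t := X (i, .RD) ⁻¹' {x | snr s (L i .RD) x < s.γth})
    ((hlaw (i, .RD)).aemeasurable.nullMeasurableSet_preimage (hS _))
  rw [hinter, hk, hk] at hunion
  rw [pathOutage, ← hunion, add_sub_cancel_right]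
  congr 1
  ext ω
  exact minSNR_lt_iff s L _ i

end Probability

lemma measureReal_forall_minSNR_lt {Ω : Type*} [MeasurableSpace Ω] {P : Measure Ω}
    [IsProbabilityMeasure P] {L : Fin 2 → Hop → Link} {X : Fin 2 × Hop → Ω → ℝ}
    (hlaw : ∀ e, HasLaw (X e) (gammaGamma (L e.1 e.2).α (L e.1 e.2).β) P)
    (hindep : iIndepFun X P) (s : OperatingPoint) :
    P.real {ω | ∀ i, minSNR s L (fun e => X e ω) i < s.γth}
      = ∏ i, pathOutage (L i) s.powerMargin := by
  have hS (i : Fin 2) : MeasurableSet {x : ℝ × ℝ |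
      snr s (L i .SR) x.1 < s.γth ∨ snr s (L i .RD) x.2 < s.γth} :=
    (measurableSet_lt ((measurable_snr s _).comp measurable_fst) measurable_const).union
      (measurableSet_lt ((measurable_snr s _).comp measurable_snd) measurable_const)
  -- The relays use disjoint pairs of links, so their path events are independent.
  have hind := hindep.indepFun_prodMk_prodMk₀ (fun e => (hlaw e).aemeasurable)
    ((0 : Fin 2), Hop.SR) (0, Hop.RD) (1, Hop.SR) (1, Hop.RD)
    (by simp) (by simp) (by simp) (by simp)
  have := hind.measure_inter_preimage_eq_mul _ _ (hS 0) (hS 1)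
  rw [Fin.prod_univ_two, ← measureReal_minSNR_lt hlaw hindep, ← measureReal_minSNR_lt hlaw hindep,
    measureReal_def, measureReal_def, measureReal_def, ← ENNReal.toReal_mul]
  congr 1
  convert this using 2
  · ext ω
    simp only [Set.mem_ofPred_eq, Fin.forall_fin_two, minSNR_lt_iff]
    rfl
  · congr 1
    ext ω
    exact minSNR_lt_iff s L _ 0
  · congr 1
    ext ω
    exact minSNR_lt_iff s L _ 1

/-! ### The switching rule and the optimal threshold. -/

/-- A kept relay is at least `T`; after a switch the old relay is already below `T`. Slot `0` is
excluded because its relay follows no rule. -/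
lemma lt_activeRelay_self_iff {T : ℝ} {γ : ℕ → Fin 2 → ℝ} {r₀ : Fin 2} {j : ℕ} (hj : 1 ≤ j) :
    γ j (activeRelay T γ r₀ j) < T ↔ ∀ i, γ j i < T := by
  obtain ⟨j, rfl⟩ := Nat.exists_eq_add_of_le' hj
  refine ⟨fun h => ?_, fun h => h _⟩
  simp only [activeRelay] at h
  split_ifs at h with hT
  · exact absurd h (not_lt.2 hT)
  · generalize activeRelay T γ r₀ j = r at *
    rw [Fin.forall_fin_two]
    fin_cases r
    · exact ⟨not_le.1 hT, h⟩
    · exact ⟨h, not_le.1 hT⟩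

section Outage

variable {Ω : Type*} [MeasurableSpace Ω] (P : Measure Ω)
  (s : OperatingPoint) (L : Fin 2 → Hop → Link) (htilde : ℕ → Fin 2 × Hop → Ω → ℝ)

lemma dsscOutage_γth (r₀ : Ω → Fin 2) {j : ℕ} (hj : 1 ≤ j) :
    dsscOutage P s L htilde r₀ s.γth j
      = P.real {ω | ∀ i, minSNR s L (fun e => htilde j e ω) i < s.γth} := by
  unfold dsscOutage
  congr 1
  ext ω
  exact lt_activeRelay_self_iff (γ := fun k i => minSNR s L (fun e => htilde k e ω) i) hj

/-- Two initial relays appear because that choice may depend on the threshold. -/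
lemma dsscOutage_γth_le [IsProbabilityMeasure P] (r₀ r₁ : Ω → Fin 2) (T : ℝ)
    {j : ℕ} (hj : 1 ≤ j) :
    dsscOutage P s L htilde r₀ s.γth j ≤ dsscOutage P s L htilde r₁ T j := by
  rw [dsscOutage_γth P s L htilde r₀ hj]
  exact measureReal_mono fun ω hω => hω _

end Outage

end FSO

/-- `l` is any mode in which the power margin tends to infinity (for instance `P_t → ∞` with the
other parameters fixed). The relay `r₀ s T` that is active in slot `0` is arbitrary and may be
chosen depending on the operating point and on the threshold, so that the stationary regime of
the protocol is included. -/
theorem corollary4 {Ω : Type*} [MeasurableSpace Ω] (P : Measure Ω) [IsProbabilityMeasure P]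
    (L : Fin 2 → FSO.Hop → FSO.Link)
    (hL : ∀ i k, ∀ n : ℤ, (L i k).α - (L i k).β ≠ (n : ℝ))
    (htilde : ℕ → Fin 2 × FSO.Hop → Ω → ℝ)
    (hlaw : ∀ j e, HasLaw (htilde j e) (FSO.gammaGamma (L e.1 e.2).α (L e.1 e.2).β) P)
    (hindep : ∀ j, iIndepFun (htilde j) P)
    (r₀ : FSO.OperatingPoint → ℝ → Ω → Fin 2) (hr₀ : ∀ s T, Measurable (r₀ s T))
    (j : ℕ) (hj : 1 ≤ j)
    (l : Filter FSO.OperatingPoint) [l.NeBot]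
    (hl : Tendsto FSO.OperatingPoint.powerMargin l atTop) :
    -- the threshold `T = γ_th` is optimal
    (∀ s : FSO.OperatingPoint,
      IsLeast ((fun T => FSO.dsscOutage P s L htilde (r₀ s T) T j) '' Set.Ioi 0)
        (FSO.dsscOutage P s L htilde (r₀ s s.γth) s.γth j)) ∧
    -- the minimum outage probability is asymptotic to the select-max expression for two relays
    (fun s => FSO.dsscOutage P s L htilde (r₀ s s.γth) s.γth j)
      ~[l] (fun s => FSO.selectMaxAsymptotic L s.powerMargin) ∧
    -- its diversity gain
    FSO.HasDiversityGain l (fun s => FSO.dsscOutage P s L htilde (r₀ s s.γth) s.γth j)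
      (∑ i : Fin 2, min (L i .SR).q (L i .RD).q) ∧
    -- this gain is the maximal one over all choices of the switching threshold
    IsGreatest
      {G : ℝ | ∃ T : FSO.OperatingPoint → ℝ, (∀ s, 0 < T s) ∧
        FSO.HasDiversityGain l (fun s => FSO.dsscOutage P s L htilde (r₀ s (T s)) (T s) j) G}
      (∑ i : Fin 2, min (L i .SR).q (L i .RD).q) := by
  -- The integer `0` suffices: it makes the Bessel order `|α - β|` positive.
  have hne (i : Fin 2) (k : FSO.Hop) : (L i k).α ≠ (L i k).β := by
    simpa [sub_eq_zero] using hL i k 0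
  have hequiv : (fun s => FSO.dsscOutage P s L htilde (r₀ s s.γth) s.γth j)
      ~[l] (fun s => FSO.selectMaxAsymptotic L s.powerMargin) := by
    have h1 (s : FSO.OperatingPoint) : FSO.dsscOutage P s L htilde (r₀ s s.γth) s.γth j =
        ∏ i, FSO.pathOutage (L i) s.powerMargin := by
      rw [FSO.dsscOutage_γth P s L htilde _ hj,
        FSO.measureReal_forall_minSNR_lt (hlaw j) (hindep j)]
    simp only [h1, FSO.selectMaxAsymptotic, Fin.prod_univ_two]
    exact ((FSO.pathOutage_isEquivalent (L 0) (hne 0)).mul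
      (FSO.pathOutage_isEquivalent (L 1) (hne 1))).comp_tendsto hl
  have hgain := FSO.hasDiversityGain_of_isEquivalent hne hl hequiv
  refine ⟨fun s => ⟨⟨s.γth, s.γth_pos, rfl⟩, ?_⟩, hequiv, hgain,
    ⟨FSO.OperatingPoint.γth, fun s => s.γth_pos, hgain⟩, ?_⟩
  · rintro _ ⟨T, -, rfl⟩
    exact FSO.dsscOutage_γth_le P s L htilde _ _ T hj
  · rintro G ⟨T, -, hG⟩
    have hratio := (isEquivalent_iff_tendsto_one (Eventually.of_forall fun s =>
      (FSO.selectMaxAsymptotic_pos L hne s.powerMargin_pos).ne')).1 hequiv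
    refine le_of_tendsto_of_tendsto hG hgain ?_
    -- Comparing gains needs `log P_M > 0` and a positive minimum outage, so that `log` is monotone
    -- there.
    filter_upwards [hl.eventually_gt_atTop 1, hratio.eventually (lt_mem_nhds one_pos)] with s hs hs'
    have hpos : 0 < FSO.dsscOutage P s L htilde (r₀ s s.γth) s.γth j :=
      (div_pos_iff_of_pos_right (FSO.selectMaxAsymptotic_pos L hne s.powerMargin_pos)).1 hs'
    have hlog := Real.log_pos hs
    have := FSO.dsscOutage_γth_le P s L htilde (r₀ s s.γth) (r₀ s (T s)) (T s) hj
    gcongr
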